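/- \textbf{Theorem 5.} Let $\mathcal{SHI}$ concepts be built from countably many atomic concepts by means of the Boolean connectives and the universal restrictions $\forall R.C$, where a role $R$ is either a role name $r$ or the inverse $r^-$ of a role name $r$; there are infinitely many ordinary role names, interpreted by arbitrary binary relations, and infinitely many transitive role names, interpreted by transitive relations, and $r^-$ is interpreted by the inverse of the interpretation of $r$. An RBox is a finite set of inclusions $R\sqsubseteq S$ between roles. Two concepts $C$ and $D$ are \emph{unifiable relative to an RBox} $B$ if there is a substitution $\sigma$ of $\mathcal{SHI}$ concepts for atomic concepts such that $\sigma(C)$ and $\sigma(D)$ have the same extension in every model of $B$. Then the following problem is undecidable: given an RBox $B$ and $\mathcal{SHI}$ concepts $C$ and $D$, decide whether $C$ and $D$ are unifiable relative to $B$. Moreover, let $r$ be an ordinary role name, let $s$ be a transitive role name, and let $B_0=\{s\sqsubseteq s^-,\ s^-\sqsubseteq s,\ r\sqsubseteq s\}$. In every model of $B_0$ the interpretation of $s$ is a transitive and symmetric relation that contains the interpretation of $r$, and the following problem is undecidable: given $\mathcal{SHI}$ concepts $C$ and $D$, decide whether $C$ and $D$ are unifiable relative to $B_0$. -/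

import Mathlib

universe u

namespace SHI

/-- Role names: infinitely many names `plain n`, interpreted by arbitrary binary relations, and
infinitely many further names `trans n`, interpreted by transitive binary relations. -/
inductive RoleName : Type
  | plain (n : ℕ)
  | trans (n : ℕ)

/-- Roles (relation symbols): the role names `r` and their inverses `r⁻`. -/
inductive Role : Type
  | name (r : RoleName)
  | inv (r : RoleName)

/-- Concepts, built from countably many atomic concepts by the Boolean connectives and the
universal restriction `∀ R. C`. (`⊥`, `⊔`, `∃ R. C` are the usual abbreviations.) -/
inductive Concept : Type
  | top
  | atom (n : ℕ)
  | neg (C : Concept)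
  | inf (C D : Concept)
  | all (R : Role) (C : Concept)

/-- An RBox: a finite list of role inclusions; the pair `(R, S)` stands for `R ⊑ S`. -/
abbrev RBox : Type := List (Role × Role)

/-- An interpretation with domain `Δ`. -/
structure Interpretation (Δ : Type u) where
  /-- the extension of each atomic concept -/
  atom : ℕ → Set Δ
  /-- the relation interpreting each role name -/
  rel : RoleName → Δ → Δ → Prop
  /-- names of transitive roles are interpreted by transitive relations -/
  rel_trans : ∀ (n : ℕ) (x y z : Δ),
    rel (.trans n) x y → rel (.trans n) y z → rel (.trans n) x z

/-- The relation interpreting a role. -/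
def Interpretation.role {Δ : Type u} (I : Interpretation Δ) : Role → Δ → Δ → Prop
  | .name r => fun x y => I.rel r x y
  | .inv r => fun x y => I.rel r y x

/-- The extension of a concept. -/
def Interpretation.ext {Δ : Type u} (I : Interpretation Δ) : Concept → Set Δ
  | .top => Set.univ
  | .atom n => I.atom n
  | .neg C => (I.ext C)ᶜ
  | .inf C D => I.ext C ∩ I.ext D
  | .all R C => {x | ∀ y, I.role R x y → y ∈ I.ext C}

/-- `I` satisfies (is a model of) the RBox `B`. -/
def Interpretation.Satisfies {Δ : Type u} (I : Interpretation Δ) (B : RBox) : Prop :=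
  ∀ p ∈ B, ∀ x y, I.role p.1 x y → I.role p.2 x y

/-- Simultaneous substitution of the concepts `σ n` for the atomic concepts. -/
def Concept.subst (σ : ℕ → Concept) : Concept → Concept
  | .top => .top
  | .atom n => σ n
  | .neg C => .neg (C.subst σ)
  | .inf C D => .inf (C.subst σ) (D.subst σ)
  | .all R C => .all R (C.subst σ)

/-- `C` and `D` are equivalent relative to `B`: they have the same extension in every model
of `B` (domains of interpretations are non-empty, as usual). -/
def EquivRel (B : RBox) (C D : Concept) : Prop :=
  ∀ (Δ : Type u) [Nonempty Δ] (I : Interpretation Δ), I.Satisfies B → I.ext C = I.ext D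

/-- `C` and `D` are unifiable relative to the RBox `B`. -/
def UnifiableRel (B : RBox) (C D : Concept) : Prop :=
  ∃ σ : ℕ → Concept, EquivRel.{u} B (C.subst σ) (D.subst σ)

/-- The RBox `s ⊑ s⁻`, `s⁻ ⊑ s`, `r ⊑ s`. -/
def symRBox (r s : RoleName) : RBox :=
  [(.name s, .inv s), (.inv s, .name s), (.name r, .name s)]

/-! Effective Gödel numberings of roles and concepts. -/

/-- A role name is a number together with its kind. -/
def RoleName.equivSum : RoleName ≃ ℕ ⊕ ℕ where
  toFun
    | .plain n => .inl n
    | .trans n => .inr n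
  invFun
    | .inl n => .plain n
    | .inr n => .trans n
  left_inv := by rintro (_ | _) <;> rfl
  right_inv := by rintro (_ | _) <;> rfl

instance : Denumerable RoleName := Denumerable.ofEquiv (ℕ ⊕ ℕ) RoleName.equivSum

/-- A role is a role name together with an inversion flag. -/
def Role.equivSum : Role ≃ RoleName ⊕ RoleName where
  toFun
    | .name r => .inl r
    | .inv r => .inr r
  invFun
    | .inl r => .name r
    | .inr r => .inv r
  left_inv := by rintro (_ | _) <;> rfl
  right_inv := by rintro (_ | _) <;> rfl

instance : Denumerable Role := Denumerable.ofEquiv (RoleName ⊕ RoleName) Role.equivSum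

/-- The Gödel number of a concept. -/
def Concept.toNat : Concept → ℕ
  | .top => 0
  | .atom n => 4 * n + 1
  | .neg C => 4 * C.toNat + 2
  | .inf C D => 4 * Nat.pair C.toNat D.toNat + 3
  | .all R C => 4 * Nat.pair (Encodable.encode R) C.toNat + 4

/-- The concept with a given Gödel number. -/
def Concept.ofNat : ℕ → Concept
  | 0 => .top
  | n + 1 =>
    have h : n / 4 < n + 1 := by omega
    have h₁ : (n / 4).unpair.1 < n + 1 := (Nat.unpair_left_le _).trans_lt h
    have h₂ : (n / 4).unpair.2 < n + 1 := (Nat.unpair_right_le _).trans_lt h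
    match n % 4 with
    | 0 => .atom (n / 4)
    | 1 => .neg (Concept.ofNat (n / 4))
    | 2 => .inf (Concept.ofNat (n / 4).unpair.1) (Concept.ofNat (n / 4).unpair.2)
    | _ => .all (Denumerable.ofNat Role (n / 4).unpair.1) (Concept.ofNat (n / 4).unpair.2)

theorem Concept.ofNat_toNat (C : Concept) : Concept.ofNat C.toNat = C := by
  induction C with
  | top => simp [Concept.toNat, Concept.ofNat]
  | atom n => simp [Concept.toNat, Concept.ofNat]
  | neg C ih =>
    have h₁ : (4 * C.toNat + 1) % 4 = 1 := by omega
    have h₂ : (4 * C.toNat + 1) / 4 = C.toNat := by omega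
    simp [Concept.toNat, Concept.ofNat, h₁, h₂, ih]
  | inf C D ihC ihD =>
    have h₁ : (4 * Nat.pair C.toNat D.toNat + 2) % 4 = 2 := by omega
    have h₂ : (4 * Nat.pair C.toNat D.toNat + 2) / 4 = Nat.pair C.toNat D.toNat := by omega
    simp [Concept.toNat, Concept.ofNat, h₁, h₂, ihC, ihD]
  | all R C ih =>
    have h₁ : (4 * Nat.pair (Encodable.encode R) C.toNat + 3) % 4 = 3 := by omega
    have h₂ : (4 * Nat.pair (Encodable.encode R) C.toNat + 3) / 4
        = Nat.pair (Encodable.encode R) C.toNat := by omega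
    simp [-Denumerable.ofEquiv_ofNat, Concept.toNat, Concept.ofNat, h₁, h₂, ih]

theorem Concept.toNat_ofNat (n : ℕ) : (Concept.ofNat n).toNat = n := by
  induction n using Nat.strong_induction_on with
  | _ n ih =>
    cases n with
    | zero => simp [Concept.toNat, Concept.ofNat]
    | succ n =>
      have h : n / 4 < n + 1 := by omega
      have h₁ : (n / 4).unpair.1 < n + 1 := (Nat.unpair_left_le _).trans_lt h
      have h₂ : (n / 4).unpair.2 < n + 1 := (Nat.unpair_right_le _).trans_lt h
      have h4 : n % 4 < 4 := Nat.mod_lt _ (by norm_num)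
      have hd := Nat.div_add_mod n 4
      rw [Concept.ofNat]
      generalize hm : n % 4 = m at h4 hd
      interval_cases m <;>
        simp [-Denumerable.ofEquiv_ofNat, Concept.toNat, ih _ h, ih _ h₁, ih _ h₂] <;> omega

/-- The Gödel numbering as a bijection. -/
def Concept.equivNat : Concept ≃ ℕ where
  toFun := Concept.toNat
  invFun := Concept.ofNat
  left_inv := Concept.ofNat_toNat
  right_inv := Concept.toNat_ofNat

instance : Denumerable Concept := Denumerable.mk' Concept.equivNat

end SHI

/-! The halting problem is reduced to unifiability with `⊤` relative to the fixed RBox.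

A universal program interpreter is written as a finite system of left linear rules that rewrite
binary trees at the root, so that a program halts iff its initial tree is rewritten to a leaf. Each
tree `t` has a concept without atoms; the variables of a rule become atomic concepts. The role names
`m + 1`, ..., `m + 4`, which the RBox does not constrain, serve to mark leaves, left edges, right
edges and derived trees. As `s` is transitive, symmetric and contains `r`, the points near a given
point form a class that is closed under `r`, and `derived m n C` has the same truth value throughout
the class. The concept to be unified with `⊤` says: if the derived trees are closed under the rules
and contain `t`, then they contain `u`.

If `t` is rewritten to `u`, there is a unifier (`unifiable_of_reaches`). A model without derived `u`
must violate closure at some step of the rewriting sequence, and a Boolean case distinction on the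
first such step selects the assignment of that step as the values of the atoms. This needs the
selected case to be constant on the class.

If a set `S` of trees is closed under rewriting and contains `t` but not `u`, no substitution is a
unifier (`not_unifiable_of_invariant`). In the model of all trees with `S` as derived trees, the
left linear rules preserve derivability whatever sets the atoms denote. For a program that does not
halt, `S` is the set of trees satisfying `Diverges`, which is closed because the interpreter is
deterministic. -/

namespace SHI

/-! ### Rewriting of binary trees at the root -/

/-- Binary trees. -/
inductive BinTree : Type
  | leaf
  | node (a b : BinTree)

/-- Binary trees with variables. -/
inductive Pattern : Type
  | var (i : ℕ)
  | leaf
  | node (a b : Pattern)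

/-- The instance of a pattern under an assignment of trees to its variables. -/
def Pattern.inst (v : ℕ → BinTree) : Pattern → BinTree
  | .var i => v i
  | .leaf => .leaf
  | .node a b => .node (a.inst v) (b.inst v)

/-- The variables of a pattern. -/
def Pattern.vars : Pattern → List ℕ
  | .var i => [i]
  | .leaf => []
  | .node a b => a.vars ++ b.vars

/-- No variable occurs twice in the pattern. -/
def Pattern.Linear (π : Pattern) : Prop := π.vars.Nodup

instance (π : Pattern) : Decidable π.Linear := inferInstanceAs (Decidable π.vars.Nodup)

theorem Pattern.inst_congr {v w : ℕ → BinTree} (π : Pattern) (h : ∀ i ∈ π.vars, v i = w i) :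
    π.inst v = π.inst w := by
  induction π with
  | var i => exact h i (by simp [vars])
  | leaf => rfl
  | node a b iha ihb =>
    rw [inst, inst, iha fun i hi => h i (by simp [vars, hi]),
      ihb fun i hi => h i (by simp [vars, hi])]

/-- `t` is rewritten to `u` in one step, at the root, by one of the rules. -/
def RewritesTo (rules : List (Pattern × Pattern)) (t u : BinTree) : Prop :=
  ∃ ρ ∈ rules, ∃ v, t = ρ.1.inst v ∧ u = ρ.2.inst v

/-- Left linear rules without new variables on the right. -/
def WellFormed (rules : List (Pattern × Pattern)) : Prop :=
  ∀ ρ ∈ rules, ρ.1.Linear ∧ ρ.2.vars ⊆ ρ.1.vars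

/-- The two patterns differ at a position at which neither has a variable. -/
def Pattern.Clash : Pattern → Pattern → Bool
  | .leaf, .node _ _ => true
  | .node _ _, .leaf => true
  | .node a b, .node c d => a.Clash c || b.Clash d
  | _, _ => false

theorem Pattern.inst_ne_of_clash {π ρ : Pattern} (h : π.Clash ρ = true) (v w : ℕ → BinTree) :
    π.inst v ≠ ρ.inst w := by
  induction π generalizing ρ with
  | var i => simp [Clash] at h
  | leaf => cases ρ <;> simp_all [Clash, inst]
  | node a b iha ihb =>
    cases ρ with
    | var i => simp [Clash] at h
    | leaf => simp [inst]
    | node c d =>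
      rw [Clash, Bool.or_eq_true] at h
      intro e
      rw [inst, inst, BinTree.node.injEq] at e
      exact h.elim (fun h => iha h e.1) fun h => ihb h e.2

theorem Pattern.eqOn_of_inst_eq {v w : ℕ → BinTree} (π : Pattern) (h : π.inst v = π.inst w) :
    ∀ i ∈ π.vars, v i = w i := by
  induction π with
  | var i => simpa [vars, inst] using h
  | leaf => simp [vars]
  | node a b iha ihb =>
    rw [inst, inst, BinTree.node.injEq] at h
    intro i hi
    rw [vars, List.mem_append] at hi
    exact hi.elim (iha h.1 i) (ihb h.2 i)

/-- Clashing left-hand sides have no common instance, so only one rule applies to `t`. The instance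
of its left-hand side fixes the values of all variables of the right-hand side. -/
theorem RewritesTo.deterministic {rules : List (Pattern × Pattern)} (hwf : WellFormed rules)
    (hr : rules.Pairwise fun ρ ρ' => ρ.1.Clash ρ'.1 = true) {t u u' : BinTree}
    (h : RewritesTo rules t u) (h' : RewritesTo rules t u') : u = u' := by
  obtain ⟨ρ, hρ, v, rfl, rfl⟩ := h
  obtain ⟨ρ', hρ', w, hw, rfl⟩ := h'
  have key : ρ = ρ' := by
    obtain ⟨i, hi, rfl⟩ := List.getElem_of_mem hρ
    obtain ⟨j, hj, rfl⟩ := List.getElem_of_mem hρ'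
    rcases lt_trichotomy i j with hij | rfl | hij
    · exact absurd hw (Pattern.inst_ne_of_clash (List.pairwise_iff_getElem.1 hr i j hi hj hij) v w)
    · rfl
    · exact absurd hw.symm
        (Pattern.inst_ne_of_clash (List.pairwise_iff_getElem.1 hr j i hj hi hij) w v)
  subst key
  exact ρ.2.inst_congr fun i hi => ρ.1.eqOn_of_inst_eq hw i ((hwf ρ hρ).2 hi)

/-! ### A universal rewriting system -/

open Turing.ToPartrec

/-- The numeral of a natural number. -/
def natTree : ℕ → BinTree
  | 0 => .leaf
  | n + 1 => .node .leaf (natTree n)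

/-- The pattern of the numeral `n`. -/
def natPattern : ℕ → Pattern
  | 0 => .leaf
  | n + 1 => .node .leaf (natPattern n)

/-- The tree of a list of natural numbers. -/
def listTree : List ℕ → BinTree
  | [] => .leaf
  | n :: l => .node (natTree n) (listTree l)

/-- The tree of a program. -/
def codeTree : Code → BinTree
  | .zero' => .node (natTree 0) .leaf
  | .succ => .node (natTree 1) .leaf
  | .tail => .node (natTree 2) .leaf
  | .cons f g => .node (natTree 3) (.node (codeTree f) (codeTree g))
  | .comp f g => .node (natTree 4) (.node (codeTree f) (codeTree g))
  | .case f g => .node (natTree 5) (.node (codeTree f) (codeTree g))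
  | .fix f => .node (natTree 6) (codeTree f)

/-- The tree of a continuation. -/
def contTree : Cont → BinTree
  | .halt => .leaf
  | .cons₁ f v k => .node (natTree 0) (.node (codeTree f) (.node (listTree v) (contTree k)))
  | .cons₂ v k => .node (natTree 1) (.node (listTree v) (contTree k))
  | .comp f k => .node (natTree 2) (.node (codeTree f) (contTree k))
  | .fix f k => .node (natTree 3) (.node (codeTree f) (contTree k))

/-- The state in which a program is about to be run. -/
def runTree (c : Code) (k : Cont) (v : List ℕ) : BinTree :=
  .node (natTree 0) (.node (codeTree c) (.node (contTree k) (listTree v)))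

/-- The state in which a value is about to be returned to a continuation. -/
def retTree (k : Cont) (v : List ℕ) : BinTree :=
  .node (natTree 1) (.node (contTree k) (listTree v))

/-- The pattern of the states in which a program is about to be run. -/
def runPattern (c k v : Pattern) : Pattern :=
  .node (natPattern 0) (.node c (.node k v))

/-- The pattern of the states in which a value is about to be returned. -/
def retPattern (k v : Pattern) : Pattern :=
  .node (natPattern 1) (.node k v)

/-- The rules of an interpreter for the programs `Turing.ToPartrec.Code`, which rewrites a
halting state to a leaf. -/
def interpreter : List (Pattern × Pattern) :=
  let x := Pattern.var 0
  let y := Pattern.var 1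
  let z := Pattern.var 2
  let k := Pattern.var 3
  let v := Pattern.var 4
  let s (x : Pattern) : Pattern := .node .leaf x
  let con (i : ℕ) (x : Pattern) : Pattern := .node (natPattern i) x
  [(runPattern (con 0 .leaf) k v, retPattern k (.node .leaf v)),
   (runPattern (con 1 .leaf) k .leaf, retPattern k (.node (s .leaf) .leaf)),
   (runPattern (con 1 .leaf) k (.node x v), retPattern k (.node (s x) .leaf)),
   (runPattern (con 2 .leaf) k .leaf, retPattern k .leaf),
   (runPattern (con 2 .leaf) k (.node x v), retPattern k v),
   (runPattern (con 3 (.node x y)) k v, runPattern x (con 0 (.node y (.node v k))) v),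
   (runPattern (con 4 (.node x y)) k v, runPattern y (con 2 (.node x k)) v),
   (runPattern (con 5 (.node x y)) k .leaf, runPattern x k .leaf),
   (runPattern (con 5 (.node x y)) k (.node .leaf v), runPattern x k v),
   (runPattern (con 5 (.node x y)) k (.node (s z) v), runPattern y k (.node z v)),
   (runPattern (con 6 x) k v, runPattern x (con 3 (.node x k)) v),
   (retPattern .leaf v, .leaf),
   (retPattern (con 0 (.node x (.node y k))) v, runPattern x (con 1 (.node v k)) y),
   (retPattern (con 1 (.node .leaf k)) v, retPattern k (.node .leaf v)),
   (retPattern (con 1 (.node (.node x y) k)) v, retPattern k (.node x v)),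
   (retPattern (con 2 (.node x k)) v, runPattern x k v),
   (retPattern (con 3 (.node x k)) .leaf, retPattern k .leaf),
   (retPattern (con 3 (.node x k)) (.node .leaf v), retPattern k v),
   (retPattern (con 3 (.node x k)) (.node (s y) v), runPattern x (con 3 (.node x k)) v)]

theorem wellFormed_interpreter : WellFormed interpreter := by
  unfold WellFormed
  decide

/-- The assignment of the given trees to the first five variables. -/
def assign (x y z k v : BinTree) : ℕ → BinTree
  | 0 => x
  | 1 => y
  | 2 => z
  | 3 => k
  | _ => v

open Relation (ReflTransGen TransGen)

/-- A rewriting sequence whose first step applies a given rule of the interpreter. -/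
theorem reaches_of_rule (i : ℕ) (x y z k v : BinTree) {t u w : BinTree}
    (hi : i < interpreter.length)
    (ht : t = (interpreter[i]).1.inst (assign x y z k v))
    (hu : u = (interpreter[i]).2.inst (assign x y z k v))
    (h : ReflTransGen (RewritesTo interpreter) u w) : TransGen (RewritesTo interpreter) t w :=
  .head' ⟨interpreter[i], List.getElem_mem hi, _, ht, hu⟩ h

/-- The tree of a machine configuration. -/
def cfgTree : Cfg → BinTree
  | .halt _ => .leaf
  | .ret k v => retTree k v

/-- `stepNormal` descends through subprograms until a value is returned; each level of the descent
is one application of a rule. -/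
theorem run_reaches (c : Code) (k : Cont) (v : List ℕ) :
    TransGen (RewritesTo interpreter) (runTree c k v) (cfgTree (stepNormal c k v)) := by
  induction c generalizing k v with
  | zero' =>
    -- The number is the position of the rule in `interpreter`; variables that do not occur in the
    -- rule are given the value `.leaf`.
    exact reaches_of_rule 0 .leaf .leaf .leaf (contTree k) (listTree v) (by decide) rfl rfl .refl
  | succ => cases v with
    | nil => exact reaches_of_rule 1 .leaf .leaf .leaf (contTree k) .leaf (by decide) rfl rfl .refl
    | cons n v =>
      exact reaches_of_rule 2 (natTree n) .leaf .leaf (contTree k) (listTree v) (by decide) rfl rfl .refl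
  | tail => cases v with
    | nil => exact reaches_of_rule 3 .leaf .leaf .leaf (contTree k) .leaf (by decide) rfl rfl .refl
    | cons n v =>
      exact reaches_of_rule 4 (natTree n) .leaf .leaf (contTree k) (listTree v) (by decide) rfl rfl .refl
  | cons f g ihf _ =>
    exact reaches_of_rule 5 (codeTree f) (codeTree g) .leaf (contTree k) (listTree v) (by decide) rfl rfl
      (ihf (.cons₁ g v k) v).to_reflTransGen
  | comp f g _ ihg =>
    exact reaches_of_rule 6 (codeTree f) (codeTree g) .leaf (contTree k) (listTree v) (by decide) rfl rfl
      (ihg (.comp f k) v).to_reflTransGen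
  | case f g ihf ihg => match v with
    | [] =>
      exact reaches_of_rule 7 (codeTree f) (codeTree g) .leaf (contTree k) .leaf (by decide) rfl rfl
        (ihf k []).to_reflTransGen
    | 0 :: v =>
      exact reaches_of_rule 8 (codeTree f) (codeTree g) .leaf (contTree k) (listTree v) (by decide) rfl rfl
        (ihf k v).to_reflTransGen
    | (n + 1) :: v =>
      exact reaches_of_rule 9 (codeTree f) (codeTree g) (natTree n) (contTree k) (listTree v) (by decide)
        rfl rfl (ihg k (n :: v)).to_reflTransGen
  | fix f ih =>
    exact reaches_of_rule 10 (codeTree f) .leaf .leaf (contTree k) (listTree v) (by decide) rfl rfl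
      (ih (.fix f k) v).to_reflTransGen

/-- That at least one rewriting step is made is essential for `Diverges.rewrite`. -/
theorem ret_reaches (k : Cont) (v : List ℕ) :
    TransGen (RewritesTo interpreter) (retTree k v) (cfgTree (stepRet k v)) := by
  induction k generalizing v with
  | halt => exact reaches_of_rule 11 .leaf .leaf .leaf .leaf (listTree v) (by decide) rfl rfl .refl
  | cons₁ f w k _ =>
    exact reaches_of_rule 12 (codeTree f) (listTree w) .leaf (contTree k) (listTree v) (by decide) rfl rfl
      (run_reaches f (.cons₂ v k) w).to_reflTransGen
  | cons₂ w k ih => cases w with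
    | nil =>
      exact reaches_of_rule 13 .leaf .leaf .leaf (contTree k) (listTree v) (by decide) rfl rfl (ih (0 :: v)).to_reflTransGen
    | cons n w =>
      exact reaches_of_rule 14 (natTree n) (listTree w) .leaf (contTree k) (listTree v) (by decide) rfl rfl
        (ih (n :: v)).to_reflTransGen
  | comp f k _ =>
    exact reaches_of_rule 15 (codeTree f) .leaf .leaf (contTree k) (listTree v) (by decide) rfl rfl
      (run_reaches f k v).to_reflTransGen
  | fix f k ih => match v with
    | [] =>
      exact reaches_of_rule 16 (codeTree f) .leaf .leaf (contTree k) .leaf (by decide) rfl rfl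
        (ih []).to_reflTransGen
    | 0 :: v =>
      exact reaches_of_rule 17 (codeTree f) .leaf .leaf (contTree k) (listTree v) (by decide) rfl rfl
        (ih v).to_reflTransGen
    | (n + 1) :: v =>
      exact reaches_of_rule 18 (codeTree f) (natTree n) .leaf (contTree k) (listTree v) (by decide) rfl rfl
        (run_reaches f (.fix f k) v).to_reflTransGen

theorem interpreter_deterministic {t u u' : BinTree} (h : RewritesTo interpreter t u)
    (h' : RewritesTo interpreter t u') : u = u' :=
  h.deterministic wellFormed_interpreter (by decide) h'

theorem reaches_leaf_of_halts {c : Code} {v : List ℕ} (h : (c.eval v).Dom) :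
    ReflTransGen (RewritesTo interpreter) (runTree c .halt v) .leaf := by
  obtain ⟨w, hw⟩ := Part.dom_iff_mem.1 h
  have hw' : Cfg.halt w ∈ StateTransition.eval step (stepNormal c Cont.halt v) := by
    rw [stepNormal_eval]
    exact Part.mem_map Cfg.halt hw
  refine (run_reaches c .halt v).to_reflTransGen.trans ?_
  have ha : ReflTransGen (fun a b => b ∈ step a) (stepNormal c Cont.halt v) (.halt w) :=
    (StateTransition.mem_eval.1 hw').1
  generalize stepNormal c Cont.halt v = a at ha
  induction ha using ReflTransGen.head_induction_on with
  | refl => exact .refl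
  | @head a b hab _ ih =>
    cases a with
    | halt _ => simp [step] at hab
    | ret k v =>
      obtain rfl : stepRet k v = b := by simpa [step] using hab
      exact (ret_reaches k v).to_reflTransGen.trans ih

/-- The trees that are rewritten to a configuration from which the machine does not halt. -/
def Diverges (t : BinTree) : Prop :=
  ∃ a, ReflTransGen (RewritesTo interpreter) t (cfgTree a) ∧ ¬ (StateTransition.eval step a).Dom

theorem eval_ret (k : Cont) (v : List ℕ) :
    StateTransition.eval step (Cfg.ret k v) = StateTransition.eval step (stepRet k v) :=
  StateTransition.reaches_eval (.single rfl)

theorem not_eval_halt (v : List ℕ) (h : ¬ (StateTransition.eval step (Cfg.halt v)).Dom) : False :=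
  h (Part.dom_iff_mem.2 ⟨Cfg.halt v, StateTransition.mem_eval.2 ⟨.refl, rfl⟩⟩)

theorem diverges_run {c : Code} {v : List ℕ} (h : ¬ (c.eval v).Dom) :
    Diverges (runTree c .halt v) :=
  ⟨stepNormal c .halt v, (run_reaches c .halt v).to_reflTransGen, by
    rw [stepNormal_eval]
    exact h⟩

/-- By determinism, every nonempty rewriting sequence from `t` passes through `u`. Hence no
description of the trees between two configurations is needed. -/
theorem Diverges.rewrite {t u : BinTree} (ht : Diverges t) (h : RewritesTo interpreter t u) :
    Diverges u := by
  obtain ⟨a, hta, ha⟩ := ht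
  have of_trans {b : Cfg} (hb : ¬ (StateTransition.eval step b).Dom)
      (htb : TransGen (RewritesTo interpreter) t (cfgTree b)) : Diverges u := by
    obtain ⟨u', hu', hb'⟩ := TransGen.head'_iff.1 htb
    obtain rfl := interpreter_deterministic h hu'
    exact ⟨b, hb', hb⟩
  -- If the sequence is empty, `t` is itself the tree of a configuration, which is replaced by its
  -- successor; this diverges as well.
  rcases Relation.reflTransGen_iff_eq_or_transGen.1 hta with hta | hta
  · cases a with
    | halt v => exact (not_eval_halt v ha).elim
    | ret k v =>
      rw [eval_ret] at ha
      exact of_trans ha (hta ▸ ret_reaches k v)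
  · exact of_trans ha hta

theorem not_diverges_leaf : ¬ Diverges .leaf := by
  rintro ⟨a, ha, h⟩
  rcases Relation.ReflTransGen.cases_head ha with ha | ⟨u, ⟨ρ, hρ, v, hu, -⟩, -⟩
  · cases a with
    | halt v => exact not_eval_halt v h
    | ret k v => simp [cfgTree, retTree] at ha
  · have : interpreter.all fun ρ => ρ.1.Clash .leaf := by decide
    exact Pattern.inst_ne_of_clash (ρ := .leaf) (List.all_eq_true.1 this ρ hρ) v v hu.symm

/-! ### Concepts that describe trees -/

/-- The implication of two concepts. -/
def Concept.imp (C D : Concept) : Concept := .neg (.inf C (.neg D))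

/-- The existential restriction. -/
def Concept.ex (R : Role) (C : Concept) : Concept := .neg (.all R (.neg C))

/-- The constant concept `∃ R. ⊤` for an ordinary role name `R`. -/
def Concept.mark (k : ℕ) : Concept := .ex (.name (.plain k)) .top

/-- A tree is a leaf. -/
def leafConcept (m : ℕ) : Concept := .mark (m + 1)

/-- An ordinary successor with the mark `k` has an ordinary successor in `C`. -/
def childConcept (m k : ℕ) (C : Concept) : Concept :=
  .ex (.name (.plain m)) (.inf (.mark k) (.ex (.name (.plain m)) C))

/-- A tree is a node with left subtree in `C` and right subtree in `D`. -/
def nodeConcept (m : ℕ) (C D : Concept) : Concept :=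
  .inf (childConcept m (m + 2) C) (childConcept m (m + 3) D)

/-- The trees that are instances of a pattern. -/
def Pattern.concept (m : ℕ) : Pattern → Concept
  | .var i => .atom i
  | .leaf => leafConcept m
  | .node a b => nodeConcept m (a.concept m) (b.concept m)

/-- The concept without atomic concepts that describes a tree. -/
def BinTree.concept (m : ℕ) : BinTree → Concept
  | .leaf => leafConcept m
  | .node a b => nodeConcept m (a.concept m) (b.concept m)

/-- Somewhere in the universe there is a derived tree in `C`. -/
def derived (m n : ℕ) (C : Concept) : Concept :=
  .neg (.inf (.neg (.inf (.mark (m + 4)) C))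
    (.all (.name (.trans n)) (.neg (.inf (.mark (m + 4)) C))))

/-- The derived trees are closed under a rule. -/
def ruleConcept (m n : ℕ) (ρ : Pattern × Pattern) : Concept :=
  .imp (derived m n (ρ.1.concept m)) (derived m n (ρ.2.concept m))

/-- The derived trees are closed under the rules. -/
def rulesConcept (m n : ℕ) : List (Pattern × Pattern) → Concept
  | [] => .top
  | ρ :: l => .inf (ruleConcept m n ρ) (rulesConcept m n l)

/-- If the derived trees are closed under the rules, and contain the first tree, then they contain
the second tree. -/
def reachConcept (m n : ℕ) (rules : List (Pattern × Pattern)) (C D : Concept) : Concept :=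
  .imp (.inf (rulesConcept m n rules) (derived m n C)) (derived m n D)

/-- Case distinction. -/
def Concept.ite (A C D : Concept) : Concept := .inf (.imp A C) (.imp (.neg A) D)

theorem BinTree.concept_subst (m : ℕ) (σ : ℕ → Concept) (t : BinTree) :
    (t.concept m).subst σ = t.concept m := by
  induction t with
  | leaf => rfl
  | node a b iha ihb =>
    simp only [BinTree.concept, nodeConcept, childConcept, Concept.subst, Concept.ex, iha, ihb,
      Concept.mark]

theorem Pattern.concept_subst (m : ℕ) (v : ℕ → BinTree) (π : Pattern) :
    (π.concept m).subst (fun i => (v i).concept m) = (π.inst v).concept m := by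
  induction π with
  | var i => rfl
  | leaf => rfl
  | node a b iha ihb =>
    simp only [BinTree.concept, Pattern.concept, Pattern.inst, nodeConcept, childConcept,
      Concept.subst, Concept.ex, iha, ihb, Concept.mark]

/-! ### Extensions of the concepts and their invariance on neighbourhoods -/

section Semantics


variable {Δ : Type u} {I : Interpretation Δ}

theorem mem_ext_imp {C D : Concept} {x : Δ} :
    x ∈ I.ext (C.imp D) ↔ (x ∈ I.ext C → x ∈ I.ext D) := by
  simp only [Concept.imp, Interpretation.ext, Set.mem_compl_iff, Set.mem_inter_iff]
  tauto

theorem mem_ext_inf {C D : Concept} {x : Δ} :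
    x ∈ I.ext (C.inf D) ↔ x ∈ I.ext C ∧ x ∈ I.ext D := Iff.rfl

theorem mem_ext_neg {C : Concept} {x : Δ} : x ∈ I.ext C.neg ↔ x ∉ I.ext C := Iff.rfl

theorem mem_ext_ex {R : Role} {C : Concept} {x : Δ} :
    x ∈ I.ext (Concept.ex R C) ↔ ∃ y, I.role R x y ∧ y ∈ I.ext C := by
  simp [Concept.ex, Interpretation.ext]

theorem mem_ext_mark {k : ℕ} {x : Δ} :
    x ∈ I.ext (Concept.mark k) ↔ ∃ y, I.rel (.plain k) x y := by
  simp [Concept.mark, mem_ext_ex, Interpretation.ext, Interpretation.role]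

theorem mem_ext_child {m k : ℕ} {C : Concept} {x : Δ} :
    x ∈ I.ext (childConcept m k C) ↔ ∃ y, I.rel (.plain m) x y ∧ y ∈ I.ext (.mark k) ∧
      ∃ z, I.rel (.plain m) y z ∧ z ∈ I.ext C := by
  simp only [childConcept, mem_ext_ex, mem_ext_inf, Interpretation.role]

theorem mem_ext_ite {A C D : Concept} {x : Δ} (h : x ∈ I.ext A) :
    x ∈ I.ext (A.ite C D) ↔ x ∈ I.ext C := by
  simp [Concept.ite, mem_ext_inf, mem_ext_imp, mem_ext_neg, h]

theorem mem_ext_ite_of_not {A C D : Concept} {x : Δ} (h : x ∉ I.ext A) :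
    x ∈ I.ext (A.ite C D) ↔ x ∈ I.ext D := by
  simp [Concept.ite, mem_ext_inf, mem_ext_imp, mem_ext_neg, h]

/-- Two points are equal or related by the transitive role `n`. -/
def Interpretation.Near (I : Interpretation Δ) (n : ℕ) (x y : Δ) : Prop :=
  x = y ∨ I.rel (.trans n) x y

theorem mem_ext_derived {m n : ℕ} {C : Concept} {x : Δ} :
    x ∈ I.ext (derived m n C) ↔
      ∃ y, I.Near n x y ∧ y ∈ I.ext (.mark (m + 4)) ∧ y ∈ I.ext C := by
  simp only [derived, Interpretation.ext, Interpretation.role, Set.mem_ofPred_eq,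
    Set.mem_compl_iff, Set.mem_inter_iff, Interpretation.Near]
  constructor
  · intro h
    by_contra! hc
    exact h ⟨fun hx => hc x (.inl rfl) hx.1 hx.2, fun y hy hxy => hc y (.inr hy) hxy.1 hxy.2⟩
  · rintro ⟨y, rfl | hy, h₁, h₂⟩ ⟨h₃, h₄⟩
    · exact h₃ ⟨h₁, h₂⟩
    · exact h₄ y hy ⟨h₁, h₂⟩

theorem mem_ext_rules {m n : ℕ} {rules : List (Pattern × Pattern)} {σ : ℕ → Concept} {x : Δ} :
    x ∈ I.ext ((rulesConcept m n rules).subst σ) ↔ ∀ ρ ∈ rules,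
      x ∈ I.ext (derived m n ((ρ.1.concept m).subst σ)) →
        x ∈ I.ext (derived m n ((ρ.2.concept m).subst σ)) := by
  induction rules with
  | nil => simp [rulesConcept, Concept.subst, Interpretation.ext]
  | cons ρ l ih =>
    rw [rulesConcept, Concept.subst, mem_ext_inf, ih, List.forall_mem_cons]
    exact and_congr_left' mem_ext_imp

theorem mem_ext_reach {m n : ℕ} {rules : List (Pattern × Pattern)} {C D : Concept}
    {σ : ℕ → Concept} {x : Δ} :
    x ∈ I.ext ((reachConcept m n rules C D).subst σ) ↔
      (x ∈ I.ext ((rulesConcept m n rules).subst σ) →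
        x ∈ I.ext (derived m n (C.subst σ)) → x ∈ I.ext (derived m n (D.subst σ))) :=
  mem_ext_imp.trans and_imp

theorem rel_symm_of_satisfies {m n : ℕ} (hI : I.Satisfies (symRBox (.plain m) (.trans n)))
    {x y : Δ} (h : I.rel (.trans n) x y) : I.rel (.trans n) y x :=
  hI (.name (.trans n), .inv (.trans n)) (by simp [symRBox]) x y h

theorem rel_of_rel_plain {m n : ℕ} (hI : I.Satisfies (symRBox (.plain m) (.trans n)))
    {x y : Δ} (h : I.rel (.plain m) x y) : I.rel (.trans n) x y :=
  hI (.name (.plain m), .name (.trans n)) (by simp [symRBox]) x y h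

theorem Interpretation.Near.trans {n : ℕ} {x y z : Δ} (h : I.Near n x y) (h' : I.Near n y z) :
    I.Near n x z := by
  rcases h with rfl | h
  · exact h'
  · rcases h' with rfl | h'
    · exact .inr h
    · exact .inr (I.rel_trans n _ _ _ h h')

theorem near_symm {m n : ℕ} (hI : I.Satisfies (symRBox (.plain m) (.trans n))) {x y : Δ}
    (h : I.Near n x y) : I.Near n y x :=
  h.imp Eq.symm (rel_symm_of_satisfies hI)

theorem mem_ext_derived_congr {m n : ℕ} {C D : Concept} {x : Δ}
    (h : ∀ y, I.Near n x y → (y ∈ I.ext C ↔ y ∈ I.ext D)) :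
    x ∈ I.ext (derived m n C) ↔ x ∈ I.ext (derived m n D) := by
  rw [mem_ext_derived, mem_ext_derived]
  exact exists_congr fun y => and_congr_right fun hy => and_congr_right fun _ => h y hy

/-- Symmetry and transitivity of `s` make nearness an equivalence relation, so near points see the
same derived trees. -/
theorem mem_ext_derived_of_near {m n : ℕ} (hI : I.Satisfies (symRBox (.plain m) (.trans n)))
    {C : Concept} {x y : Δ} (hxy : I.Near n x y) :
    y ∈ I.ext (derived m n C) ↔ x ∈ I.ext (derived m n C) := by
  rw [mem_ext_derived, mem_ext_derived]
  exact ⟨fun ⟨z, hz, h⟩ => ⟨z, hxy.trans hz, h⟩,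
    fun ⟨z, hz, h⟩ => ⟨z, (near_symm hI hxy).trans hz, h⟩⟩

/-- Substitutions that agree on the neighbourhood of a point agree there on patterns. -/
theorem mem_ext_pattern_congr {m n : ℕ} (hI : I.Satisfies (symRBox (.plain m) (.trans n)))
    {σ τ : ℕ → Concept} {x : Δ} (h : ∀ i y, I.Near n x y → (y ∈ I.ext (σ i) ↔ y ∈ I.ext (τ i)))
    (π : Pattern) (y : Δ) (hy : I.Near n x y) :
    y ∈ I.ext ((π.concept m).subst σ) ↔ y ∈ I.ext ((π.concept m).subst τ) := by
  induction π generalizing y with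
  | var i => exact h i y hy
  | leaf => exact Iff.rfl
  | node a b iha ihb =>
    have child (k : ℕ) {C D : Concept}
        (hCD : ∀ y, I.Near n x y → (y ∈ I.ext C ↔ y ∈ I.ext D)) :
        y ∈ I.ext (childConcept m k C) ↔ y ∈ I.ext (childConcept m k D) := by
      rw [mem_ext_child, mem_ext_child]
      refine exists_congr fun z => and_congr_right fun hyz => and_congr_right fun _ =>
        exists_congr fun w => and_congr_right fun hzw => hCD w ?_
      -- Two steps along `r` stay in the neighbourhood, since `r ⊑ s` and `s` is transitive.
      exact hy.trans (.inr (I.rel_trans n _ _ _ (rel_of_rel_plain hI hyz)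
        (rel_of_rel_plain hI hzw)))
    exact and_congr (child (m + 2) iha) (child (m + 3) ihb)

end Semantics


/-! ### Unifiers from rewriting sequences -/

open Relation (ReflTransGen)

/-- If a tree is rewritten to another one, then a substitution makes the concept that expresses
this valid. -/
theorem unifiable_of_reaches {rules : List (Pattern × Pattern)} {m n : ℕ} {t u : BinTree}
    (h : ReflTransGen (RewritesTo rules) t u) :
    UnifiableRel.{u} (symRBox (.plain m) (.trans n))
      (reachConcept m n rules (t.concept m) (u.concept m)) .top := by
  -- The concepts of trees contain no atoms, so the substitution acts on the rules only.
  suffices H : ∃ σ : ℕ → Concept, ∀ (Δ : Type u) (I : Interpretation Δ) (x : Δ),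
      I.Satisfies (symRBox (.plain m) (.trans n)) →
      x ∈ I.ext ((rulesConcept m n rules).subst σ) →
      x ∈ I.ext (derived m n (t.concept m)) → x ∈ I.ext (derived m n (u.concept m)) by
    obtain ⟨σ, hσ⟩ := H
    refine ⟨σ, fun Δ _ I hI => Set.eq_univ_of_forall fun x => ?_⟩
    rw [mem_ext_reach, BinTree.concept_subst, BinTree.concept_subst]
    exact hσ Δ I x hI
  induction h using ReflTransGen.head_induction_on with
  | refl => exact ⟨fun _ => .top, fun _ _ _ _ _ h => h⟩
  | @head t t' htt' _ ih =>
    obtain ⟨σ, hσ⟩ := ih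
    obtain ⟨ρ, hρ, v, rfl, rfl⟩ := htt'
    set t := ρ.1.inst v
    set t' := ρ.2.inst v
    -- use the assignment `v` where this step fails, and the substitution `σ` elsewhere
    set A : Concept := .inf (derived m n (t.concept m)) (.neg (derived m n (t'.concept m)))
    refine ⟨fun i => A.ite ((v i).concept m) (σ i), fun Δ I x hI hx ht => ?_⟩
    -- The truth value of `A` is constant near `x`, so the new substitution agrees there entirely
    -- with `v` or entirely with `σ`.
    have hA (y : Δ) (hy : I.Near n x y) : y ∈ I.ext A ↔ x ∉ I.ext (derived m n (t'.concept m)) := by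
      simp only [A, mem_ext_inf, mem_ext_neg, mem_ext_derived_of_near hI hy, ht, true_and]
    rw [mem_ext_rules] at hx
    have ht' : x ∈ I.ext (derived m n (t'.concept m)) := by
      -- Otherwise the substitution acts near `x` as `v`, and the rule `ρ` becomes the implication
      -- from derived `t` to derived `t'`.
      by_contra ht'
      have key := mem_ext_pattern_congr hI (x := x)
        (σ := fun i => A.ite ((v i).concept m) (σ i)) (τ := fun i => (v i).concept m)
        fun i y hy => mem_ext_ite ((hA y hy).2 ht')
      have := hx ρ hρ
      rw [mem_ext_derived_congr (key ρ.1), mem_ext_derived_congr (key ρ.2),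
        Pattern.concept_subst, Pattern.concept_subst] at this
      exact ht' (this ht)
    -- Now `A` fails near `x`, so the rules hold under `σ` too, and the rest of the sequence
    -- applies.
    refine hσ Δ I x hI (mem_ext_rules.2 fun ρ' hρ' => ?_) ht'
    have key := mem_ext_pattern_congr hI (x := x)
      (σ := fun i => A.ite ((v i).concept m) (σ i)) (τ := σ)
      fun i y hy => mem_ext_ite_of_not fun hy' => (hA y hy).1 hy' ht'
    rw [← mem_ext_derived_congr (key ρ'.1), ← mem_ext_derived_congr (key ρ'.2)]
    exact hx ρ' hρ'

/-! ### The model of trees -/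

/-- The points are the trees `t` and for every tree two edges, `(t, true)` to its left and
`(t, false)` to its right subtree. -/
abbrev TreePoint : Type u := ULift.{u} (BinTree ⊕ BinTree × Bool)

instance : Nonempty BinTree := ⟨.leaf⟩

/-- The ordinary relation: a tree is related to its edges, and they are related to the subtrees. -/
def TreeRel : BinTree ⊕ BinTree × Bool → BinTree ⊕ BinTree × Bool → Prop
  | .inl t, .inr (s, _) => s = t
  | .inr (.node a _, true), .inl t => a = t
  | .inr (.node _ b, false), .inl t => b = t
  | _, _ => False

/-- The interpretation in which the derived trees are those of `S`. -/
def treeModel (m n : ℕ) (S : Set BinTree) : Interpretation TreePoint.{u} where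
  -- Any choice would do: the values of a substitution matter only as arbitrary sets of points.
  atom _ := ∅
  rel
    | .plain k, x, y =>
      -- A marked point is related to all points, because a mark only asks for the existence of a
      -- successor.
      (k = m ∧ TreeRel x.down y.down) ∨ (k = m + 1 ∧ x.down = .inl .leaf) ∨
        (k = m + 2 ∧ ∃ t, x.down = .inr (t, true)) ∨
        (k = m + 3 ∧ ∃ t, x.down = .inr (t, false)) ∨ (k = m + 4 ∧ ∃ t ∈ S, x.down = .inl t)
    -- The role `s` is universal, so all points are near each other; the other transitive roles are
    -- empty.
    | .trans k, _, _ => k = n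
  rel_trans _ _ _ _ h _ := h

variable {m n : ℕ} {S : Set BinTree}

theorem treeModel_satisfies :
    (treeModel.{u} m n S).Satisfies (symRBox (.plain m) (.trans n)) := by
  intro p hp x y h
  simp only [symRBox, List.mem_cons, List.not_mem_nil, or_false] at hp
  rcases hp with rfl | rfl | rfl
  · exact h
  · exact h
  · exact rfl

theorem treeModel_rel {x y : TreePoint.{u}} :
    (treeModel.{u} m n S).rel (.plain m) x y ↔ TreeRel x.down y.down := by
  simp [treeModel]

theorem mem_treeModel_leaf {x : TreePoint.{u}} :
    x ∈ (treeModel.{u} m n S).ext (leafConcept m) ↔ x.down = .inl .leaf := by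
  simp [leafConcept, mem_ext_mark, treeModel]

theorem mem_treeModel_derived {C : Concept} {x : TreePoint.{u}} :
    x ∈ (treeModel.{u} m n S).ext (derived m n C) ↔
      ∃ t ∈ S, ULift.up (.inl t) ∈ (treeModel.{u} m n S).ext C := by
  have near (y : TreePoint.{u}) : (treeModel.{u} m n S).Near n x y := .inr rfl
  have mark (y : TreePoint.{u}) : y ∈ (treeModel.{u} m n S).ext (.mark (m + 4)) ↔
      ∃ t ∈ S, y.down = .inl t := by
    simp [mem_ext_mark, treeModel]
  simp only [mem_ext_derived, mark, near, true_and]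
  constructor
  · rintro ⟨⟨y⟩, ⟨t, ht, rfl⟩, h⟩
    exact ⟨t, ht, h⟩
  · rintro ⟨t, ht, h⟩
    exact ⟨⟨.inl t⟩, ⟨t, ht, rfl⟩, h⟩

/-- Every tree has exactly one edge of each kind, and an edge leads to at most one subtree, so the
two existential restrictions determine the subtrees. The edges of a leaf lead nowhere. -/
theorem mem_treeModel_node {C D : Concept} {x : TreePoint.{u}} :
    x ∈ (treeModel.{u} m n S).ext (nodeConcept m C D) ↔ ∃ a b, x.down = .inl (.node a b) ∧
      ULift.up (.inl a) ∈ (treeModel.{u} m n S).ext C ∧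
      ULift.up (.inl b) ∈ (treeModel.{u} m n S).ext D := by
  have left (y : TreePoint.{u}) : y ∈ (treeModel.{u} m n S).ext (.mark (m + 2)) ↔
      ∃ t, y.down = .inr (t, true) := by
    simp [mem_ext_mark, treeModel]
  have right (y : TreePoint.{u}) : y ∈ (treeModel.{u} m n S).ext (.mark (m + 3)) ↔
      ∃ t, y.down = .inr (t, false) := by
    simp [mem_ext_mark, treeModel]
  rw [nodeConcept, mem_ext_inf, mem_ext_child, mem_ext_child]
  simp only [left, right, treeModel_rel]
  constructor
  · rintro ⟨⟨⟨y⟩, hxy, ⟨t, rfl⟩, ⟨z⟩, hyz, hz⟩, ⟨y'⟩, hxy', ⟨t', rfl⟩, ⟨z'⟩, hyz', hz'⟩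
    obtain ⟨x | x⟩ := x
    · obtain rfl : t = x := hxy
      obtain rfl : t' = t := hxy'
      cases t' with
      | leaf => exact hyz.elim
      | node a b =>
        cases z with
        | inr z => exact hyz.elim
        | inl z =>
          cases z' with
          | inr z' => exact hyz'.elim
          | inl z' =>
            obtain rfl : a = z := hyz
            obtain rfl : b = z' := hyz'
            exact ⟨a, b, rfl, hz, hz'⟩
    · simp [TreeRel] at hxy
  · rintro ⟨a, b, hx, ha, hb⟩
    rw [hx]
    exact ⟨⟨⟨.inr (.node a b, true)⟩, rfl, ⟨_, rfl⟩, ⟨.inl a⟩, rfl, ha⟩,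
      ⟨⟨.inr (.node a b, false)⟩, rfl, ⟨_, rfl⟩, ⟨.inl b⟩, rfl, hb⟩⟩

theorem mem_treeModel_tree {t : BinTree} {x : TreePoint.{u}} :
    x ∈ (treeModel.{u} m n S).ext (t.concept m) ↔ x.down = .inl t := by
  induction t generalizing x with
  | leaf => exact mem_treeModel_leaf
  | node a b iha ihb =>
    rw [BinTree.concept, mem_treeModel_node]
    simp only [iha, ihb, Sum.inl.injEq]
    exact ⟨fun ⟨_, _, h, h₁, h₂⟩ => h₁ ▸ h₂ ▸ h, fun h => ⟨a, b, h, rfl, rfl⟩⟩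

/-- Repeated variables do no harm in this direction, so right-hand sides may copy trees, as the
interpreter does. -/
theorem mem_treeModel_inst {σ : ℕ → Concept} {v : ℕ → BinTree} (π : Pattern)
    (h : ∀ i ∈ π.vars, ULift.up (.inl (v i)) ∈ (treeModel.{u} m n S).ext (σ i)) :
    ULift.up (.inl (π.inst v)) ∈ (treeModel.{u} m n S).ext ((π.concept m).subst σ) := by
  induction π with
  | var i => exact h i (by simp [Pattern.vars])
  | leaf => exact mem_treeModel_leaf.2 rfl
  | node a b iha ihb =>
    exact mem_treeModel_node.2 ⟨_, _, rfl, iha fun i hi => h i (by simp [Pattern.vars, hi]),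
      ihb fun i hi => h i (by simp [Pattern.vars, hi])⟩

/-- Linearity allows the assignments found for the two subtrees to be glued together. A repeated
variable could be matched by two different trees in the extension of `σ i`. -/
theorem exists_inst_of_mem_treeModel {σ : ℕ → Concept} (π : Pattern) (hπ : π.Linear)
    {t : BinTree}
    (h : ULift.up (.inl t) ∈ (treeModel.{u} m n S).ext ((π.concept m).subst σ)) :
    ∃ v, t = π.inst v ∧
      ∀ i ∈ π.vars, ULift.up (.inl (v i)) ∈ (treeModel.{u} m n S).ext (σ i) := by
  induction π generalizing t with
  | var i => exact ⟨fun _ => t, rfl, fun j hj => by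
      obtain rfl : j = i := by simpa [Pattern.vars] using hj
      exact h⟩
  | leaf =>
    have : (ULift.up.{u} (Sum.inl t : BinTree ⊕ BinTree × Bool)).down = .inl .leaf :=
      mem_treeModel_leaf.1 h
    exact ⟨fun _ => t, Sum.inl_injective this, by simp [Pattern.vars]⟩
  | node a b iha ihb =>
    obtain ⟨c, d, hcd, hc, hd⟩ := mem_treeModel_node.1 h
    obtain ⟨ha, hb, hab⟩ := List.nodup_append'.1 hπ
    obtain ⟨v, rfl, hv⟩ := iha ha hc
    obtain ⟨w, rfl, hw⟩ := ihb hb hd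
    have ea : ∀ i ∈ a.vars, (if i ∈ a.vars then v i else w i) = v i := fun i hi => if_pos hi
    have eb : ∀ i ∈ b.vars, (if i ∈ a.vars then v i else w i) = w i :=
      fun i hi => if_neg fun hi' => hab hi' hi
    refine ⟨fun i => if i ∈ a.vars then v i else w i, ?_, fun i hi => ?_⟩
    · rw [Pattern.inst, a.inst_congr ea, b.inst_congr eb]
      exact Sum.inl_injective hcd
    · rcases List.mem_append.1 hi with hi | hi
      · simpa only [ea i hi] using hv i hi
      · simpa only [eb i hi] using hw i hi

/-- A set of trees that is closed under the rules, and contains the first tree but not the second,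
refutes all substitution instances. -/
theorem not_unifiable_of_invariant {rules : List (Pattern × Pattern)} (hwf : WellFormed rules)
    {t u : BinTree} (ht : t ∈ S) (hu : u ∉ S)
    (hS : ∀ a b, a ∈ S → RewritesTo rules a b → b ∈ S) :
    ¬ UnifiableRel.{u} (symRBox (.plain m) (.trans n))
      (reachConcept m n rules (t.concept m) (u.concept m)) .top := by
  rintro ⟨σ, hσ⟩
  have h : ULift.up (.inl t) ∈ (treeModel.{u} m n S).ext
      ((reachConcept m n rules (t.concept m) (u.concept m)).subst σ) := by
    have : Nonempty TreePoint.{u} := ⟨⟨.inl t⟩⟩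
    rw [hσ _ _ treeModel_satisfies]
    trivial
  rw [mem_ext_reach, BinTree.concept_subst, BinTree.concept_subst, mem_treeModel_derived,
    mem_treeModel_derived] at h
  -- The trees matched by the variables of the left-hand side lie in the extensions of their `σ i`,
  -- so the rewritten tree, which is in `S`, lies in the extension of the right-hand side.
  obtain ⟨w, hw, hwu⟩ := h (mem_ext_rules.2 fun ρ hρ => by
    rw [mem_treeModel_derived, mem_treeModel_derived]
    rintro ⟨s, hs, hsρ⟩
    obtain ⟨v, rfl, hv⟩ := exists_inst_of_mem_treeModel ρ.1 (hwf ρ hρ).1 hsρ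
    exact ⟨ρ.2.inst v, hS _ _ hs ⟨ρ, hρ, v, rfl, rfl⟩,
      mem_treeModel_inst ρ.2 fun i hi => hv i ((hwf ρ hρ).2 hi)⟩)
    ⟨t, ht, mem_treeModel_tree.2 rfl⟩
  obtain rfl : w = u := Sum.inl_injective (mem_treeModel_tree.1 hwu)
  exact hu hw

/-- Unifiability expresses the halting of programs. -/
theorem unifiable_iff_halts (m n : ℕ) (c : Turing.ToPartrec.Code) (v : List ℕ) :
    UnifiableRel.{u} (symRBox (.plain m) (.trans n))
      (reachConcept m n interpreter ((runTree c .halt v).concept m) (BinTree.leaf.concept m)) .top ↔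
      (c.eval v).Dom := by
  refine ⟨fun h => ?_, fun h => unifiable_of_reaches (reaches_leaf_of_halts h)⟩
  by_contra hd
  exact not_unifiable_of_invariant (S := {t | Diverges t}) wellFormed_interpreter
    (diverges_run hd) not_diverges_leaf (fun _ _ => Diverges.rewrite) h

/-! ### Computability of the reduction -/

/-- Concepts are encoded by `Concept.toNat`, so a constructor amounts to an arithmetic operation on
Gödel numbers. -/
theorem primrec_neg : Primrec Concept.neg :=
  Primrec.encode_iff.1 <| Primrec.nat_add.comp
    (Primrec.nat_mul.comp (Primrec.const 4) Primrec.encode) (Primrec.const 2)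

theorem primrec_inf : Primrec₂ Concept.inf :=
  Primrec.encode_iff.1 <| Primrec.nat_add.comp
    (Primrec.nat_mul.comp (Primrec.const 4) (Primrec₂.natPair.comp
      (Primrec.encode.comp Primrec.fst) (Primrec.encode.comp Primrec.snd))) (Primrec.const 3)

theorem primrec_all (R : Role) : Primrec (Concept.all R) :=
  Primrec.encode_iff.1 <| Primrec.nat_add.comp
    (Primrec.nat_mul.comp (Primrec.const 4) (Primrec₂.natPair.comp
      (Primrec.const (Encodable.encode R)) Primrec.encode)) (Primrec.const 4)

theorem primrec_ex (R : Role) : Primrec (Concept.ex R) :=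
  primrec_neg.comp ((primrec_all R).comp primrec_neg)

theorem primrec_child (m k : ℕ) : Primrec (childConcept m k) :=
  (primrec_ex _).comp (primrec_inf.comp (Primrec.const _) (primrec_ex _))

theorem primrec_node (m : ℕ) : Primrec₂ (nodeConcept m) :=
  primrec_inf.comp ((primrec_child m (m + 2)).comp Primrec.fst)
    ((primrec_child m (m + 3)).comp Primrec.snd)

theorem primrec_derived (m n : ℕ) : Primrec (derived m n) := by
  have h : Primrec fun C => Concept.neg (.inf (.mark (m + 4)) C) :=
    primrec_neg.comp (primrec_inf.comp (Primrec.const _) Primrec.id)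
  exact primrec_neg.comp (primrec_inf.comp h ((primrec_all _).comp h))

theorem primrec_reach (m n : ℕ) (rules : List (Pattern × Pattern)) (D : Concept) :
    Primrec fun C => reachConcept m n rules C D :=
  primrec_neg.comp (primrec_inf.comp
    (primrec_inf.comp (Primrec.const _) (primrec_derived m n)) (Primrec.const _))

theorem primrec_natTree_concept (m : ℕ) : Primrec fun k => (natTree k).concept m := by
  refine (Primrec.nat_rec₁ (leafConcept m) (f := fun _ C => nodeConcept m (leafConcept m) C)
    ((primrec_node m).comp (Primrec.const _) Primrec.snd)).of_eq fun k => ?_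
  induction k with
  | zero => rfl
  | succ k ih =>
    rw [natTree, BinTree.concept, ← ih]
    rfl

/-- With the program fixed, only the numeral of the input varies, so no computation on programs is
involved. -/
theorem primrec_runTree_concept (m : ℕ) (c : Turing.ToPartrec.Code) :
    Primrec fun k => (runTree c .halt [k]).concept m := by
  have const (C : Concept) : Primrec fun _ : ℕ => C := Primrec.const C
  exact (primrec_node m).comp (const _) ((primrec_node m).comp (const _)
    ((primrec_node m).comp (const _)
      ((primrec_node m).comp (primrec_natTree_concept m) (const _))))

/-- A program whose halting problem is undecidable. -/
theorem exists_undecidable_program : ∃ c : Turing.ToPartrec.Code,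
    ∀ k : ℕ, (c.eval [k]).Dom ↔
      ((Denumerable.ofNat Nat.Partrec.Code k).eval 0).Dom := by
  have hf : Partrec fun k : ℕ => (Denumerable.ofNat Nat.Partrec.Code k).eval 0 :=
    Nat.Partrec.Code.eval_part.comp (Computable.ofNat _) (Computable.const 0)
  obtain ⟨c, hc⟩ := Turing.ToPartrec.Code.exists_code (Nat.Partrec'.part_iff₁.2 hf)
  refine ⟨c, fun k => ?_⟩
  have := hc (k ::ᵥ List.Vector.nil)
  rw [show (k ::ᵥ List.Vector.nil : List.Vector ℕ 1).1 = [k] from rfl] at this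
  rw [this]
  exact Iff.rfl

/-- Halting of a code on input `0` is many-one reduced to unifiability: one fixed program receives
the number of the code as its input. -/
theorem not_computablePred_unifiable_symRBox (m n : ℕ) :
    ¬ ComputablePred fun p : Concept × Concept =>
      UnifiableRel.{u} (symRBox (.plain m) (.trans n)) p.1 p.2 := by
  intro h
  obtain ⟨c, hc⟩ := exists_undecidable_program
  refine ComputablePred.halting_problem 0 (ComputablePred.computable_of_manyOneReducible
    ⟨fun d => (reachConcept m n interpreter
      ((runTree c .halt [Encodable.encode d]).concept m) (BinTree.leaf.concept m), .top),
      ?_, fun d => ?_⟩ h)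
  · exact (Primrec.pair ((primrec_reach m n interpreter _).comp
      ((primrec_runTree_concept m c).comp Primrec.encode)) (Primrec.const _)).to_comp
  · rw [unifiable_iff_halts, hc, Denumerable.ofNat_encode]

end SHI

theorem theorem5 :
    (¬ ComputablePred fun p : SHI.RBox × SHI.Concept × SHI.Concept =>
      SHI.UnifiableRel.{u} p.1 p.2.1 p.2.2) ∧
    ∀ m n : ℕ,
      (∀ (Δ : Type u) [Nonempty Δ] (I : SHI.Interpretation Δ),
        I.Satisfies (SHI.symRBox (.plain m) (.trans n)) →
          (∀ x y z, I.rel (.trans n) x y → I.rel (.trans n) y z → I.rel (.trans n) x z) ∧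
          (∀ x y, I.rel (.trans n) x y → I.rel (.trans n) y x) ∧
          (∀ x y, I.rel (.plain m) x y → I.rel (.trans n) x y)) ∧
      ¬ ComputablePred fun p : SHI.Concept × SHI.Concept =>
        SHI.UnifiableRel.{u} (SHI.symRBox (.plain m) (.trans n)) p.1 p.2 := by
  -- The problem with the RBox as part of the input contains the problem for one fixed RBox.
  refine ⟨fun h => SHI.not_computablePred_unifiable_symRBox.{u} 0 0
    (ComputablePred.computable_of_manyOneReducible
      ⟨fun p => (SHI.symRBox (.plain 0) (.trans 0), p),
        Computable.pair (Computable.const _) Computable.id, fun _ => Iff.rfl⟩ h),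
    fun m n => ⟨fun Δ _ I hI => ⟨I.rel_trans n, fun _ _ => SHI.rel_symm_of_satisfies hI,
      fun _ _ => SHI.rel_of_rel_plain hI⟩, SHI.not_computablePred_unifiable_symRBox m n⟩⟩
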